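/- Let $\mathbb{K}=\mathbb{R}$ or $\mathbb{C}$ and let $V\subset\mathbb{K}^n$ (resp. $V\subset\mathbb{P}^n_{\mathbb{K}}$) be an affine (resp. projective) algebraic set. Let $g_1,\dots,g_s$, $g_i=\sum_\alpha g_{i,\alpha}x^\alpha$, be generators of the ideal $I(V)$ of all polynomials vanishing on $V$, an ideal of $\mathbb{K}[x]=\mathbb{K}[x_1,\dots,x_n]$ (resp. the homogeneous ideal $I(V)$ of $\mathbb{K}[x]=\mathbb{K}[x_0,\dots,x_n]$). For $\varepsilon>0$, call an algebraic set $W\subset\mathbb{K}^n$ (resp. $W\subset\mathbb{P}^n_{\mathbb{K}}$) an *$\varepsilon$-approximation of $V$ over $\overline{\mathbb{Q}}$* if $I(W)$ is generated by polynomials $g'_1,\dots,g'_s$, $g'_i=\sum_\alpha g'_{i,\alpha}x^\alpha$, such that (a) all $g'_{i,\alpha}$ lie in $\overline{\mathbb{Q}}\cap\mathbb{K}$; (b) $|g_{i,\alpha}-g'_{i,\alpha}|<\varepsilon$ for all $i$ and $\alpha$; (c) every polynomial relation with rational coefficients satisfied by the $g_{i,\alpha}$ is also satisfied by the $g'_{i,\alpha}$.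 The Hilbert–Samuel function of an affine algebraic set $V$ is $d\mapsto\dim_{\mathbb{K}}\mathbb{K}[x]_{\le d}/(I(V)\cap\mathbb{K}[x]_{\le d})$, where $\mathbb{K}[x]_{\le d}$ is the space of polynomials of degree at most $d$; that of a projective algebraic set is $d\mapsto\dim_{\mathbb{K}}\mathbb{K}[x]_{d}/(I(V)\cap\mathbb{K}[x]_{d})$, where $\mathbb{K}[x]_{d}$ is the space of homogeneous polynomials of degree $d$. Then, in the affine and in the projective case: 1. There is $\varepsilon_0>0$ (depending on the $g_i$) such that for every $0<\varepsilon<\varepsilon_0$, every $\varepsilon$-approximation $W$ of $V$ over $\overline{\mathbb{Q}}$ has the same Hilbert–Samuel function as $V$. 2. Moreover, for every monomial order and every Gröbner basis $h_1,\dots,h_r$ of $I(V)$ for this order (with all $h_j\ne 0$), there is $\varepsilon_0>0$ such that for every $0<\varepsilon<\varepsilon_0$ and every $\varepsilon$-approximation $W$ of $V$ over $\overline{\mathbb{Q}}$, the ideal $I(W)$ has a Gröbner basis $h'_1,\dots,h'_r$ for the same order such that, for every $j$, the leading exponents of $h'_j$ and $h_j$ are equal and $\operatorname{Supp}(h'_j)\subset\operatorname{Supp}(h_j)$,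 where $\operatorname{Supp}(f)$ is the set of exponents of the monomials occurring in $f$ with nonzero coefficient. -/

import Mathlib

open scoped LinearAlgebra.Projectivization

/-- `V ⊆ Kⁿ` is an (affine) algebraic set: the common zero set of a set of polynomials. -/
def IsAffineAlgebraicSet {K : Type*} [Field K] {n : ℕ} (V : Set (Fin n → K)) : Prop :=
  ∃ S : Set (MvPolynomial (Fin n) K), V = {x | ∀ f ∈ S, MvPolynomial.eval x f = 0}

/-- The affine cone (without its vertex) over a subset `V` of `ℙⁿ(K)`:
all the vectors of homogeneous coordinates of the points of `V`. -/
def coneOver {K : Type*} [Field K] {n : ℕ} (V : Set (ℙ K (Fin (n + 1) → K))) :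
    Set (Fin (n + 1) → K) :=
  {v | ∃ hv : v ≠ 0, Projectivization.mk K v hv ∈ V}

/-- `V ⊆ ℙⁿ(K)` is a (projective) algebraic set: the common zero set of a set of homogeneous
polynomials. -/
def IsProjectiveAlgebraicSet {K : Type*} [Field K] {n : ℕ}
    (V : Set (ℙ K (Fin (n + 1) → K))) : Prop :=
  ∃ S : Set (MvPolynomial (Fin (n + 1)) K), (∀ f ∈ S, ∃ d : ℕ, f.IsHomogeneous d) ∧
    V = {p | ∀ f ∈ S, MvPolynomial.eval p.rep f = 0}

/-- The ideal of `K[x₁, …, xₙ]` defining an affine algebraic set: all the polynomials vanishing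
on it. -/
noncomputable def affineIdeal {K : Type*} [Field K] {n : ℕ} (V : Set (Fin n → K)) :
    Ideal (MvPolynomial (Fin n) K) :=
  MvPolynomial.vanishingIdeal K V

/-- The ideal of `K[x₀, …, xₙ]` defining a projective algebraic set: all the polynomials vanishing
at every choice of homogeneous coordinates of every point of the set (for infinite `K` it is
homogeneous). -/
noncomputable def projectiveIdeal {K : Type*} [Field K] {n : ℕ}
    (V : Set (ℙ K (Fin (n + 1) → K))) : Ideal (MvPolynomial (Fin (n + 1)) K) :=
  MvPolynomial.vanishingIdeal K (coneOver V)

/-- The Hilbert–Samuel function of an affine algebraic set `V`: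
`d ↦ dim_K (K[x]_{≤ d} / (I(V) ∩ K[x]_{≤ d}))`. -/
noncomputable def affineHilbertSamuel {K : Type*} [Field K] {n : ℕ} (V : Set (Fin n → K))
    (d : ℕ) : ℕ :=
  Module.finrank K
    (MvPolynomial.restrictTotalDegree (Fin n) K d ⧸
      ((affineIdeal V).restrictScalars K).submoduleOf
        (MvPolynomial.restrictTotalDegree (Fin n) K d))

/-- The Hilbert–Samuel function of a projective algebraic set `V`:
`d ↦ dim_K (K[x]_d / (I(V) ∩ K[x]_d))`. -/
noncomputable def projectiveHilbertSamuel {K : Type*} [Field K] {n : ℕ}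
    (V : Set (ℙ K (Fin (n + 1) → K))) (d : ℕ) : ℕ :=
  Module.finrank K
    (MvPolynomial.homogeneousSubmodule (Fin (n + 1)) K d ⧸
      ((projectiveIdeal V).restrictScalars K).submoduleOf
        (MvPolynomial.homogeneousSubmodule (Fin (n + 1)) K d))

/-- The polynomials `g'₁, …, g'ₛ` have algebraic coefficients, their coefficients are at distance
less than `ε` from those of `g₁, …, gₛ`, and every polynomial relation with rational coefficients
satisfied by the coefficients of the `gᵢ` is satisfied by the coefficients of the `g'ᵢ`.
The coefficient of `x^α` in `gᵢ` is substituted for the variable of index `(i, α)`. -/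
structure IsAlgebraicApproximation {K : Type*} [RCLike K] {σ : Type*} {s : ℕ} (ε : ℝ)
    (g g' : Fin s → MvPolynomial σ K) : Prop where
  algebraic : ∀ i α, IsAlgebraic ℚ ((g' i).coeff α)
  close : ∀ i α, ‖(g i).coeff α - (g' i).coeff α‖ < ε
  relations : ∀ P : MvPolynomial (Fin s × (σ →₀ ℕ)) ℚ,
    MvPolynomial.aeval (fun p : Fin s × (σ →₀ ℕ) => (g p.1).coeff p.2) P = 0 →
    MvPolynomial.aeval (fun p : Fin s × (σ →₀ ℕ) => (g' p.1).coeff p.2) P = 0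

/-- `h₁, …, hᵣ` is a Gröbner basis of the ideal `I` for the monomial order `m`: the `hⱼ` are nonzero
elements of `I` and the leading exponent of each nonzero element of `I` is divisible by
(componentwise at least) the leading exponent of some `hⱼ`. -/
def IsGroebnerBasis {K : Type*} [Field K] {σ : Type*} (m : MonomialOrder σ) {r : ℕ}
    (h : Fin r → MvPolynomial σ K) (I : Ideal (MvPolynomial σ K)) : Prop :=
  (∀ j, h j ∈ I ∧ h j ≠ 0) ∧ ∀ f ∈ I, f ≠ 0 → ∃ j, m.degree (h j) ≤ m.degree f

/-! Let `A ⊆ K` be the ℚ-algebra generated by the coefficients of the `gᵢ`. Condition (c) says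
exactly that sending these coefficients to those of the `g'ᵢ` defines a ring homomorphism `φ : A →
K`. So the task is to specialize a Gröbner basis along `φ`.

By `exists_mem_span_support_subset`, the basis can be taken in the ideal generated over `A`, without
new monomials. Once the product `c` of its leading coefficients is inverted, division works over `B
= A[1/c]`: the ideal and the span of the standard monomials are complementary in `B[x]`. This
splitting survives any base change `B → K` (`isGroebnerBasis_map`). Finally `c` is a rational
polynomial in the coefficients of the `gᵢ`, so `φ c ≠ 0` for small `ε` by continuity.

The Hilbert–Samuel functions count standard exponents, hence depend only on the leading exponents of
a Gröbner basis. -/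

section GroebnerSpecialization

open MvPolynomial MonomialOrder

/-! ### Division, standard exponents and change of coefficients -/

/-- The exponents divisible by the leading exponent of none of the `hⱼ`. -/
def standardExponents {R σ : Type*} [CommSemiring R] (m : MonomialOrder σ) {r : ℕ}
    (h : Fin r → MvPolynomial σ R) : Set (σ →₀ ℕ) :=
  {c | ∀ j, ¬ m.degree (h j) ≤ c}

theorem IsGroebnerBasis.eq_zero_of_mem_restrictSupport {K σ : Type*} [Field K]
    {m : MonomialOrder σ} {r : ℕ} {h : Fin r → MvPolynomial σ K} {I : Ideal (MvPolynomial σ K)}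
    (hI : IsGroebnerBasis m h I) {f : MvPolynomial σ K} (hf : f ∈ I)
    (hs : f ∈ restrictSupport K (standardExponents m h)) : f = 0 := by
  by_contra h0
  obtain ⟨j, hj⟩ := hI.2 f hf h0
  exact (mem_restrictSupport_iff _).1 hs (m.degree_mem_support h0) j hj

/-- Unit leading coefficients allow division over a ring. The bound on the support of `f - p` serves
the degree count in the affine case. -/
theorem exists_sub_mem_span_range {R σ : Type*} [CommRing R]
    (m : MonomialOrder σ) {r : ℕ} {h : Fin r → MvPolynomial σ R}
    (hu : ∀ j, IsUnit (m.leadingCoeff (h j))) (f : MvPolynomial σ R) :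
    ∃ p ∈ restrictSupport R (standardExponents m h), f - p ∈ Ideal.span (Set.range h) ∧
      ∀ c ∈ (f - p).support, c ≼[m] m.degree f := by
  obtain ⟨q, p, hf, hdeg, hp⟩ := m.div hu f
  have hsub : f - p = Finsupp.linearCombination _ h q := by rw [hf]; ring
  refine ⟨p, (mem_restrictSupport_iff _).2 fun c hc => hp c hc, ?_, ?_⟩
  · rw [hsub]
    exact (Finsupp.mem_span_range_iff_exists_finsupp).2 ⟨q, rfl⟩
  · intro c hc
    refine (m.le_degree hc).trans ?_
    rw [hsub, Finsupp.linearCombination_apply, Finsupp.sum]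
    refine m.degree_sum_le.trans (Finset.sup_le fun i _ => ?_)
    rw [smul_eq_mul, mul_comm]
    exact hdeg i

/-- The remainder of `f ∈ I` is standard and lies in `I`, so it vanishes. Then `f` is a sum of
products `h i * q i` of degree at most that of `f`, and one of them must attain it. -/
theorem isGroebnerBasis_of_inf_eq_bot {K σ : Type*} [Field K]
    {m : MonomialOrder σ} {r : ℕ} {h : Fin r → MvPolynomial σ K} {I : Ideal (MvPolynomial σ K)}
    (hmem : ∀ j, h j ∈ I ∧ h j ≠ 0)
    (hI : ∀ f ∈ I, f ∈ restrictSupport K (standardExponents m h) → f = 0) :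
    IsGroebnerBasis m h I := by
  refine ⟨hmem, fun f hf h0 => ?_⟩
  obtain ⟨q, p, hfq, hdeg, hp⟩ := m.div (b := h)
    (fun j => (m.leadingCoeff_ne_zero_iff.2 (hmem j).2).isUnit) f
  have hq : Finsupp.linearCombination _ h q ∈ I := by
    rw [Finsupp.linearCombination_apply, Finsupp.sum]
    exact Ideal.sum_mem _ fun i _ => I.mul_mem_left _ (hmem i).1
  have hp0 : p = 0 := hI p ((Ideal.add_mem_iff_right I hq).1 (hfq ▸ hf))
    ((mem_restrictSupport_iff _).2 fun c hc => hp c hc)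
  rw [hp0, add_zero, Finsupp.linearCombination_apply, Finsupp.sum] at hfq
  have hc : coeff (m.degree f) f ≠ 0 := m.coeff_degree_ne_zero_iff.2 h0
  conv at hc => lhs; arg 2; rw [hfq]
  rw [coeff_sum] at hc
  obtain ⟨i, _, hi⟩ := Finset.exists_ne_zero_of_sum_ne_zero hc
  rw [smul_eq_mul, mul_comm] at hi
  have h1 : h i * q i ≠ 0 := fun h2 => hi (by rw [h2, coeff_zero])
  have h2 : m.degree (h i * q i) = m.degree f :=
    m.toSyn.injective (le_antisymm (hdeg i) (m.le_degree (mem_support_iff.2 hi)))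
  refine ⟨i, ?_⟩
  rw [← h2, m.degree_mul' h1]
  exact le_self_add

theorem degree_map_of_leadingCoeff_ne_zero {R S σ : Type*} [CommSemiring R] [CommSemiring S]
    (m : MonomialOrder σ) (φ : R →+* S) {f : MvPolynomial σ R} (hf : φ (m.leadingCoeff f) ≠ 0) :
    m.degree (map φ f) = m.degree f := by
  refine m.toSyn.injective (le_antisymm (m.degree_le_iff.2 fun c hc => m.le_degree ?_) ?_)
  · exact support_map_subset _ _ hc
  · exact m.le_degree (mem_support_iff.2 (by rwa [coeff_map]))

theorem standardExponents_congr {R S σ : Type*} [CommSemiring R] [CommSemiring S]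
    {m : MonomialOrder σ} {r : ℕ} {h : Fin r → MvPolynomial σ R} {h' : Fin r → MvPolynomial σ S}
    (hd : ∀ j, m.degree (h j) = m.degree (h' j)) :
    standardExponents m h = standardExponents m h' := by
  simp only [standardExponents, hd]

theorem map_mem_restrictSupport {R S σ : Type*} [CommSemiring R] [CommSemiring S]
    (φ : R →+* S) {s : Set (σ →₀ ℕ)} {f : MvPolynomial σ R} (hf : f ∈ restrictSupport R s) :
    map φ f ∈ restrictSupport S s :=
  (mem_restrictSupport_iff _).2 fun _ hc =>
    (mem_restrictSupport_iff _).1 hf (support_map_subset _ _ hc)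

theorem map_mem_span_range {R S σ ι : Type*} [CommSemiring R] [CommSemiring S]
    (φ : R →+* S) {g : ι → MvPolynomial σ R} {f : MvPolynomial σ R}
    (hf : f ∈ Ideal.span (Set.range g)) :
    map φ f ∈ Ideal.span (Set.range fun i => map φ (g i)) := by
  have := Ideal.mem_map_of_mem (map φ) hf
  rwa [Ideal.map_span, ← Set.range_comp] at this

/-! ### Specialization of a Gröbner basis with unit leading coefficients -/

section Specialization

variable {B K σ : Type*} [CommRing B] [Field K] {ψ φ : B →+* K} {m : MonomialOrder σ} {r : ℕ}
  {H : Fin r → MvPolynomial σ B} {I : Ideal (MvPolynomial σ K)}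

theorem degree_map_of_isUnit (φ : B →+* K) {f : MvPolynomial σ B}
    (hu : IsUnit (m.leadingCoeff f)) : m.degree (map φ f) = m.degree f :=
  degree_map_of_leadingCoeff_ne_zero m φ (hu.map φ).ne_zero

theorem eq_zero_of_map_isGroebnerBasis (hψ : Function.Injective ψ)
    (hu : ∀ j, IsUnit (m.leadingCoeff (H j))) (hI : IsGroebnerBasis m (fun j => map ψ (H j)) I)
    {f : MvPolynomial σ B} (hf : map ψ f ∈ I)
    (hs : f ∈ restrictSupport B (standardExponents m H)) : f = 0 := by
  refine map_injective ψ hψ ((hI.eq_zero_of_mem_restrictSupport hf ?_).trans (map_zero _).symm)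
  rw [standardExponents_congr fun j => degree_map_of_isUnit ψ (hu j)]
  exact map_mem_restrictSupport ψ hs

/-- The remainder of `f` over `B` is standard and its image lies in `I`, so it is zero. -/
theorem mem_span_of_map_mem (hψ : Function.Injective ψ)
    (hu : ∀ j, IsUnit (m.leadingCoeff (H j))) (hI : IsGroebnerBasis m (fun j => map ψ (H j)) I)
    {f : MvPolynomial σ B} (hf : map ψ f ∈ I) : f ∈ Ideal.span (Set.range H) := by
  obtain ⟨p, hp, hfp, -⟩ := exists_sub_mem_span_range m hu f
  have hle : Ideal.span (Set.range fun j => map ψ (H j)) ≤ I :=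
    Ideal.span_le.2 (by rintro _ ⟨j, rfl⟩; exact (hI.1 j).1)
  have h1 := hle (map_mem_span_range ψ hfp)
  rw [map_sub] at h1
  have hp0 : p = 0 := eq_zero_of_map_isGroebnerBasis hψ hu hI
    ((Submodule.sub_mem_iff_right I hf).1 h1) hp
  simpa [hp0] using hfp

/-- A Gröbner basis with invertible leading coefficients specializes to a Gröbner basis. -/
theorem isGroebnerBasis_map (hψ : Function.Injective ψ)
    (hu : ∀ j, IsUnit (m.leadingCoeff (H j)))
    (hI : IsGroebnerBasis m (fun j => map ψ (H j)) I) (φ : B →+* K) :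
    IsGroebnerBasis m (fun j => map φ (H j)) (Ideal.span (Set.range fun j => map φ (H j))) := by
  set J := Ideal.span (Set.range H)
  set T := restrictSupport B (standardExponents m H)
  have hJT : ∀ f ∈ J, f ∈ T → f = 0 := by
    intro f hf hs
    refine eq_zero_of_map_isGroebnerBasis hψ hu hI ?_ hs
    exact Ideal.span_le.2 (by rintro _ ⟨j, rfl⟩; exact (hI.1 j).1) (map_mem_span_range ψ hf)
  choose N hNT hNJ _ using fun f => exists_sub_mem_span_range m hu f
  -- The chosen remainders `N` need not be linear, so the normal form is rebuilt linearly from its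
  -- values on monomials. It is the projection onto `T` along `J`.
  let R : MvPolynomial σ B →ₗ[B] MvPolynomial σ B :=
    (basisMonomials σ B).constr B fun c => N (monomial c 1)
  have hR1 (c) : R (monomial c 1) = N (monomial c 1) := by
    have := (basisMonomials σ B).constr_basis B (fun c => N (monomial c 1)) c
    rwa [coe_basisMonomials] at this
  have hRc (c) (a : B) : R (monomial c a) = a • N (monomial c 1) := by
    rw [← hR1, ← map_smul, smul_monomial, smul_eq_mul, mul_one]
  have hRT (f) : R f ∈ T ∧ f - R f ∈ J := by
    induction f using MvPolynomial.induction_on' with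
    | monomial c a =>
      rw [hRc]
      refine ⟨T.smul_mem _ (hNT _), ?_⟩
      rw [← mul_one a, ← smul_eq_mul, ← smul_monomial, smul_eq_mul, mul_one, ← smul_sub,
        smul_eq_C_mul]
      exact J.mul_mem_left _ (hNJ _)
    | add p q hp hq =>
      rw [map_add, add_sub_add_comm]
      exact ⟨T.add_mem hp.1 hq.1, J.add_mem hp.2 hq.2⟩
  have hRJ (f) (hf : f ∈ J) : R f = 0 :=
    hJT _ ((Submodule.sub_mem_iff_right J hf).1 (hRT f).2) (hRT f).1
  have hRfix (f) (hf : f ∈ T) : R f = f :=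
    (sub_eq_zero.1 (hJT _ (hRT f).2 (T.sub_mem hf (hRT f).1))).symm
  -- The base change of `R` along `φ`: it kills the specialized ideal and fixes standard
  -- polynomials, so the two meet only in zero.
  let R' : MvPolynomial σ K →ₗ[K] MvPolynomial σ K :=
    (basisMonomials σ K).constr K fun c => map φ (N (monomial c 1))
  have hR'1 (c) (a : K) : R' (monomial c a) = a • map φ (N (monomial c 1)) := by
    have := (basisMonomials σ K).constr_basis K (fun c => map φ (N (monomial c 1))) c
    rw [coe_basisMonomials] at this
    rw [← this, ← map_smul, smul_monomial, smul_eq_mul, mul_one]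
  have hRR' (f) : R' (map φ f) = map φ (R f) := by
    induction f using MvPolynomial.induction_on' with
    | monomial c a => rw [map_monomial, hR'1, hRc, smul_eq_C_mul, smul_eq_C_mul, map_mul, map_C]
    | add p q hp hq => simp only [map_add, hp, hq]
  have hR'J (p : MvPolynomial σ K) (j) : R' (p * map φ (H j)) = 0 := by
    induction p using MvPolynomial.induction_on' with
    | monomial c a =>
      -- The scalar `a` may lie outside the image of `φ`, but the monic monomial multiple lifts to
      -- `J`, where `R` vanishes.
      have : monomial c a * map φ (H j) = a • map φ (monomial c 1 * H j) := by
        rw [map_mul, map_monomial, map_one, ← smul_mul_assoc, smul_monomial, smul_eq_mul, mul_one]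
      rw [this, map_smul, hRR', hRJ _ (J.mul_mem_left _ (Ideal.subset_span ⟨j, rfl⟩)), map_zero,
        smul_zero]
    | add p q hp hq => rw [add_mul, map_add, hp, hq, add_zero]
  have hR'fix (f) (hf : f ∈ restrictSupport K (standardExponents m H)) : R' f = f := by
    rw [restrictSupport_eq_span] at hf
    induction hf using Submodule.span_induction with
    | mem x hx =>
      obtain ⟨c, hc, rfl⟩ := hx
      have h1 : monomial c (1 : B) ∈ T := by
        refine (mem_restrictSupport_iff _).2 fun d hd => ?_
        rw [Finset.mem_singleton.1 (support_monomial_subset hd)]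
        exact hc
      have h2 := hRR' (monomial c 1)
      rw [hRfix _ h1, map_monomial, map_one] at h2
      exact h2
    | zero => exact map_zero _
    | add x y _ _ hx hy => rw [map_add, hx, hy]
    | smul a x _ hx => rw [map_smul, hx]
  refine isGroebnerBasis_of_inf_eq_bot (fun j => ⟨Ideal.subset_span ⟨j, rfl⟩, ?_⟩) ?_
  · intro h0
    refine ((hu j).map φ).ne_zero ?_
    rw [MonomialOrder.leadingCoeff, ← coeff_map, h0, coeff_zero]
  · intro f hf hs
    rw [standardExponents_congr fun j => degree_map_of_isUnit φ (hu j)] at hs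
    rw [← hR'fix f hs]
    obtain ⟨q, rfl⟩ := Finsupp.mem_span_range_iff_exists_finsupp.1 hf
    rw [Finsupp.sum, map_sum]
    exact Finset.sum_eq_zero fun i _ => hR'J _ _

end Specialization

/-! ### Descent of a Gröbner basis to the ring of coefficients -/

section Descent

variable {A K σ : Type*} [CommRing A] [Field K] [Algebra A K]

attribute [local instance] algebraMvPolynomial

/-- Membership in an ideal descends to a subfield, with the coefficients moved by any linear
retraction of the field onto the subfield. -/
theorem exists_mem_span_coeff_eq {L ι : Type*} [Field L] [Algebra L K] (π : K →ₗ[L] L)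
    {g : ι → MvPolynomial σ L} {f : MvPolynomial σ K}
    (hf : f ∈ Ideal.span (Set.range fun i => map (algebraMap L K) (g i))) :
    ∃ p ∈ Ideal.span (Set.range g), ∀ c, coeff c p = π (coeff c f) := by
  classical
  obtain ⟨q, rfl⟩ := Finsupp.mem_span_range_iff_exists_finsupp.1 hf
  -- Applying `π` coefficientwise commutes with multiplication by each `g i`, because `π` is
  -- `L`-linear.
  let P (x : MvPolynomial σ K) : MvPolynomial σ L :=
    ∑ c ∈ x.support, monomial c (π (coeff c x))
  have hP (x c) : coeff c (P x) = π (coeff c x) := by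
    simp only [P, coeff_sum, coeff_monomial, Finset.sum_ite_eq', mem_support_iff]
    split_ifs with h
    · rfl
    · rw [not_not.1 h, map_zero]
  refine ⟨q.sum fun i a => P a * g i, ?_, fun c => ?_⟩
  · exact Ideal.sum_mem _ fun i _ => Ideal.mul_mem_left _ _ (Ideal.subset_span ⟨i, rfl⟩)
  · rw [Finsupp.sum, Finsupp.sum, coeff_sum, coeff_sum, map_sum]
    refine Finset.sum_congr rfl fun i _ => ?_
    rw [smul_eq_mul, coeff_mul, coeff_mul, map_sum]
    refine Finset.sum_congr rfl fun x _ => ?_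
    rw [hP, coeff_map, mul_comm (coeff x.1 _) (algebraMap L K _), ← Algebra.smul_def, map_smul,
      smul_eq_mul, mul_comm]

/-- An element of an ideal generated by polynomials over a domain `A` can be replaced by one with
coefficients in `A`, with no new monomials and retaining a given one. -/
theorem exists_mem_span_support_subset {ι : Type*} (hA : Function.Injective (algebraMap A K))
    {g : ι → MvPolynomial σ A} {f : MvPolynomial σ K}
    (hf : f ∈ Ideal.span (Set.range fun i => map (algebraMap A K) (g i)))
    {d : σ →₀ ℕ} (hd : coeff d f ≠ 0) :
    ∃ p ∈ Ideal.span (Set.range g), (∀ c, coeff c f = 0 → coeff c p = 0) ∧ coeff d p ≠ 0 := by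
  have : FaithfulSMul A K := (faithfulSMul_iff_algebraMap_injective A K).2 hA
  have : IsDomain A := IsDomain.of_faithfulSMul A K
  let L := FractionRing A
  let _ : Algebra L K := FractionRing.liftAlgebra A K
  have : IsScalarTower A L K := FractionRing.isScalarTower_liftAlgebra A K
  obtain ⟨π₀, hπ₀⟩ := (Algebra.linearMap L K).exists_leftInverse_of_injective
    (LinearMap.ker_eq_bot.2 (algebraMap L K).injective)
  have hπ₁ : π₀ 1 = 1 := by simpa using LinearMap.congr_fun hπ₀ 1
  -- Dividing first by `coeff d f` makes `π` send that coefficient to 1, so the monomial `d`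
  -- survives.
  let π : K →ₗ[L] L := π₀ ∘ₗ LinearMap.restrictScalars L (LinearMap.mulLeft K (coeff d f)⁻¹)
  have hg (i) : map (algebraMap A K) (g i) = map (algebraMap L K) (map (algebraMap A L) (g i)) := by
    rw [map_map, ← IsScalarTower.algebraMap_eq]
  simp only [hg] at hf
  obtain ⟨p, hp, hpf⟩ := exists_mem_span_coeff_eq π hf
  have hp' : p ∈ Ideal.map (algebraMap (MvPolynomial σ A) (MvPolynomial σ L))
      (Ideal.span (Set.range g)) := by
    rw [Ideal.map_span, ← Set.range_comp]
    exact hp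
  obtain ⟨⟨q, ⟨_, b, hb, rfl⟩⟩, hq⟩ := (IsLocalization.mem_map_algebraMap_iff
    ((nonZeroDivisors A).map (C (σ := σ))) (MvPolynomial σ L)).1 hp'
  have hb0 : algebraMap A L b ≠ 0 :=
    fun h => nonZeroDivisors.ne_zero hb (IsFractionRing.injective A L (h.trans (map_zero _).symm))
  have hqc (c) : algebraMap A L (coeff c q.1) = π (coeff c f) * algebraMap A L b := by
    have h := congrArg (coeff c) hq
    simp only [algebraMap_def, map_C] at h
    rw [coeff_map, mul_comm, coeff_C_mul, hpf, mul_comm] at h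
    exact h.symm
  refine ⟨q.1, q.2, fun c hc => IsFractionRing.injective A L ?_, fun h => ?_⟩
  · rw [hqc, hc, map_zero, zero_mul, map_zero]
  · have := hqc d
    rw [h, map_zero] at this
    refine mul_ne_zero ?_ hb0 this.symm
    simp [π, hd, hπ₁]

theorem exists_isGroebnerBasis_specialization {m : MonomialOrder σ} {s r : ℕ}
    (hA : Function.Injective (algebraMap A K)) (G : Fin s → MvPolynomial σ A)
    {h : Fin r → MvPolynomial σ K}
    (hh : IsGroebnerBasis m h (Ideal.span (Set.range fun i => map (algebraMap A K) (G i)))) :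
    ∃ c : A, c ≠ 0 ∧ ∀ φ : A →+* K, φ c ≠ 0 → ∃ h' : Fin r → MvPolynomial σ K,
      IsGroebnerBasis m h' (Ideal.span (Set.range fun i => map φ (G i))) ∧
        ∀ j, m.degree (h' j) = m.degree (h j) ∧ (h' j).support ⊆ (h j).support := by
  have : FaithfulSMul A K := (faithfulSMul_iff_algebraMap_injective A K).2 hA
  have : IsDomain A := IsDomain.of_faithfulSMul A K
  choose H hHG hsupp hlead using fun j => exists_mem_span_support_subset hA (hh.1 j).1
    (m.coeff_degree_ne_zero_iff.2 (hh.1 j).2)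
  have hHh (j) : (H j).support ⊆ (h j).support := fun c hc =>
    mem_support_iff.2 fun h0 => mem_support_iff.1 hc (hsupp j c h0)
  have hdeg (j) : m.degree (H j) = m.degree (h j) :=
    m.toSyn.injective (le_antisymm (m.degree_le_iff.2 fun c hc => m.le_degree (hHh j hc))
      (m.le_degree (mem_support_iff.2 (hlead j))))
  have hlead0 (j) : m.leadingCoeff (H j) ≠ 0 := by
    rw [MonomialOrder.leadingCoeff, hdeg]
    exact hlead j
  set c := ∏ j, m.leadingCoeff (H j)
  have hc0 : c ≠ 0 := Finset.prod_ne_zero_iff.2 fun j _ => hlead0 j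
  refine ⟨c, hc0, fun φ hφ => ?_⟩
  -- Both the inclusion `A → K` and `φ` extend to `B`, and the first extension stays injective.
  let B := Localization.Away c
  let ψB : B →+* K := IsLocalization.Away.lift c
    (IsUnit.mk0 (algebraMap A K c) ((map_ne_zero_iff _ hA).2 hc0))
  let φB : B →+* K := IsLocalization.Away.lift c (IsUnit.mk0 (φ c) hφ)
  have hψB : ψB.comp (algebraMap A B) = algebraMap A K := IsLocalization.Away.lift_comp ..
  have hφB : φB.comp (algebraMap A B) = φ := IsLocalization.Away.lift_comp ..
  have hψinj : Function.Injective ψB :=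
    (IsLocalization.lift_injective_iff _).2 fun x y => by
      rw [hA.eq_iff]
      exact (IsLocalization.injective B
        (powers_le_nonZeroDivisors_of_noZeroDivisors hc0)).eq_iff
  have hunit (j) : IsUnit (algebraMap A B (m.leadingCoeff (H j))) :=
    isUnit_of_dvd_unit (map_dvd _ (Finset.dvd_prod_of_mem (fun j => m.leadingCoeff (H j)) (Finset.mem_univ j)))
      (IsLocalization.Away.algebraMap_isUnit c)
  have : Nontrivial B := ψB.domain_nontrivial
  have hdegB (j) : m.degree (map (algebraMap A B) (H j)) = m.degree (H j) :=
    degree_map_of_leadingCoeff_ne_zero m _ (hunit j).ne_zero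
  have hu (j) : IsUnit (m.leadingCoeff (map (algebraMap A B) (H j))) := by
    rw [MonomialOrder.leadingCoeff, hdegB, coeff_map]
    exact hunit j
  have hψH (j) : map ψB (map (algebraMap A B) (H j)) = map (algebraMap A K) (H j) := by
    rw [map_map, hψB]
  have hφH (j) : map φB (map (algebraMap A B) (H j)) = map φ (H j) := by
    rw [map_map, hφB]
  have hGB : IsGroebnerBasis m (fun j => map ψB (map (algebraMap A B) (H j)))
      (Ideal.span (Set.range fun i => map (algebraMap A K) (G i))) := by
    refine ⟨fun j => ⟨?_, ?_⟩, fun f hf h0 => ?_⟩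
    · dsimp only
      rw [hψH]
      exact map_mem_span_range _ (hHG j)
    · dsimp only
      intro h0
      rw [hψH, map_eq_zero_iff _ (map_injective _ hA)] at h0
      exact hlead j (by rw [h0, coeff_zero])
    · obtain ⟨j, hj⟩ := hh.2 f hf h0
      exact ⟨j, by rwa [degree_map_of_isUnit ψB (hu j), hdegB, hdeg]⟩
  have hspec := isGroebnerBasis_map hψinj hu hGB φB
  have hspan : Ideal.span (Set.range fun j => map φB (map (algebraMap A B) (H j))) =
      Ideal.span (Set.range fun i => map φ (G i)) := by
    refine le_antisymm (Ideal.span_le.2 ?_) (Ideal.span_le.2 ?_)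
    · rintro _ ⟨j, rfl⟩
      simp only [hφH]
      exact map_mem_span_range φ (hHG j)
    · rintro _ ⟨i, rfl⟩
      -- The generators are combinations of the `H j` already over `B`, so this relation can be
      -- transported along `φB`.
      have h1 : map (algebraMap A B) (G i) ∈
          Ideal.span (Set.range fun j => map (algebraMap A B) (H j)) := by
        refine mem_span_of_map_mem hψinj hu hGB ?_
        rw [map_map, hψB]
        exact Ideal.subset_span ⟨i, rfl⟩
      have h2 := map_mem_span_range φB h1
      rwa [map_map, hφB] at h2
  rw [hspan] at hspec
  refine ⟨_, hspec, fun j => ⟨?_, ?_⟩⟩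
  · rw [degree_map_of_isUnit φB (hu j), hdegB, hdeg]
  · rw [hφH]
    exact (support_map_subset _ _).trans (hHh j)

end Descent

/-! ### Approximations as specializations -/

theorem exists_pos_forall_aeval_ne_zero {K ι : Type*} [RCLike K] (P : MvPolynomial ι ℚ)
    {x : ι → K} (hx : aeval x P ≠ 0) :
    ∃ ε₀ > (0 : ℝ), ∀ y : ι → K, (∀ i, ‖x i - y i‖ < ε₀) → aeval y P ≠ 0 := by
  have hopen : IsOpen {y : ι → K | aeval y P ≠ 0} := by
    simp only [aeval_def, eval₂_eq_eval_map]
    exact isOpen_ne_fun (continuous_eval (map (algebraMap ℚ K) P)) continuous_const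
  -- A product neighbourhood constrains only finitely many coordinates, so one radius suffices.
  obtain ⟨J, u, hu, hJ⟩ := isOpen_pi_iff.1 hopen x hx
  have hball : ∀ i : J, ∃ δ > 0, Metric.ball (x i) δ ⊆ u i := fun i =>
    Metric.isOpen_iff.1 (hu i i.2).1 _ (hu i i.2).2
  choose δ hδ hδu using hball
  obtain ⟨ε₀, hε₀, hle⟩ : ∃ ε₀ > (0 : ℝ), ∀ i, ε₀ ≤ δ i := by
    rcases isEmpty_or_nonempty J with hE | hN
    · exact ⟨1, one_pos, fun i => (hE.false i).elim⟩
    · obtain ⟨i, hi⟩ := Finite.exists_min δ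
      exact ⟨δ i, hδ i, hi⟩
  refine ⟨ε₀, hε₀, fun y hy => hJ fun i hi => hδu ⟨i, hi⟩ ?_⟩
  rw [Metric.mem_ball, dist_comm, dist_eq_norm]
  exact (hy i).trans_le (hle ⟨i, hi⟩)

/-- Approximations close enough to given generators inherit a given Gröbner basis: the leading
exponents are the same and no new monomials occur. -/
theorem exists_isGroebnerBasis_of_isAlgebraicApproximation {K σ : Type*} [RCLike K]
    {m : MonomialOrder σ} {s r : ℕ} {g : Fin s → MvPolynomial σ K} {h : Fin r → MvPolynomial σ K}
    (hh : IsGroebnerBasis m h (Ideal.span (Set.range g))) :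
    ∃ ε₀ > (0 : ℝ), ∀ ε < ε₀, ∀ g' : Fin s → MvPolynomial σ K, IsAlgebraicApproximation ε g g' →
      ∃ h' : Fin r → MvPolynomial σ K, IsGroebnerBasis m h' (Ideal.span (Set.range g')) ∧
        ∀ j, m.degree (h' j) = m.degree (h j) ∧ (h' j).support ⊆ (h j).support := by
  let x : Fin s × (σ →₀ ℕ) → K := fun p => (g p.1).coeff p.2
  let F : MvPolynomial (Fin s × (σ →₀ ℕ)) ℚ →ₐ[ℚ] K := aeval x
  let A : Subalgebra ℚ K := F.range
  have hxA (p) : x p ∈ A := ⟨X p, aeval_X x p⟩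
  let G : Fin s → MvPolynomial σ A := fun i =>
    ∑ c ∈ (g i).support, monomial c ⟨x (i, c), hxA _⟩
  have hGc (φ : A →+* K) (i c) : coeff c (map φ (G i)) = φ ⟨x (i, c), hxA _⟩ := by
    classical
    simp only [G, coeff_map, coeff_sum, coeff_monomial, Finset.sum_ite_eq', mem_support_iff]
    split_ifs with h0
    · rfl
    · congr 1
      exact Subtype.ext (not_not.1 h0).symm
  have hG (i) : map (algebraMap A K) (G i) = g i := by
    ext c
    exact hGc _ i c
  have hh' : IsGroebnerBasis m h
      (Ideal.span (Set.range fun i => map (algebraMap A K) (G i))) := by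
    simpa only [hG] using hh
  obtain ⟨⟨_, P, rfl⟩, hc0, hspec⟩ := exists_isGroebnerBasis_specialization
    Subtype.val_injective G hh'
  have hP : aeval x P ≠ 0 := fun h0 => hc0 (Subtype.ext h0)
  obtain ⟨ε₀, hε₀, hne⟩ := exists_pos_forall_aeval_ne_zero P hP
  refine ⟨ε₀, hε₀, fun ε hε g' hg' => ?_⟩
  let x' : Fin s × (σ →₀ ℕ) → K := fun p => (g' p.1).coeff p.2
  -- Well defined because the kernel of evaluation at `x` is contained in that at `x'`, by condition
  -- (c).
  let φ : A →ₐ[ℚ] K := AlgHom.liftOfSurjective F.rangeRestrict F.rangeRestrict_surjective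
    (aeval x') fun Q hQ => hg'.relations Q (congrArg Subtype.val hQ)
  have hφ (Q) : φ (F.rangeRestrict Q) = aeval x' Q := AlgHom.liftOfSurjective_apply ..
  have hφG (i) : map (φ : A →+* K) (G i) = g' i := by
    ext c
    rw [hGc]
    have h1 := hφ (X (i, c))
    rw [aeval_X] at h1
    refine Eq.trans ?_ h1
    exact congrArg φ (Subtype.ext (aeval_X x (i, c)).symm)
  obtain ⟨h', hgb, hd⟩ := hspec φ <| by
    have h1 := hne x' fun p => (hg'.close p.1 p.2).trans hε
    rwa [← hφ] at h1
  simp only [hφG] at hgb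
  exact ⟨h', hgb, hd⟩

/-- Dickson's lemma: the minimal leading exponents form an antichain in a well-quasi-order, hence a
finite set. -/
theorem exists_isGroebnerBasis {K σ : Type*} [Field K] [Finite σ] (m : MonomialOrder σ)
    (I : Ideal (MvPolynomial σ K)) :
    ∃ (r : ℕ) (h : Fin r → MvPolynomial σ K), IsGroebnerBasis m h I := by
  let P : (σ →₀ ℕ) → Prop := fun c => ∃ f ∈ I, f ≠ 0 ∧ m.degree f = c
  have hfin : {c | Minimal P c}.Finite :=
    (setOfPred_minimal_antichain P).finite_of_partiallyWellOrderedOn (Set.isPWO_of_wellQuasiOrderedLE _)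
  choose! F hFI hF0 hFd using fun c (hc : Minimal P c) => hc.prop
  have := hfin.to_subtype
  obtain ⟨r, ⟨e⟩⟩ := Finite.exists_equiv_fin {c | Minimal P c}
  refine ⟨r, fun j => F (e.symm j), fun j => ⟨hFI _ (e.symm j).2, hF0 _ (e.symm j).2⟩,
    fun f hf h0 => ?_⟩
  obtain ⟨c, hcf, hc⟩ := exists_minimal_le_of_wellFoundedLT P _ ⟨f, hf, h0, rfl⟩
  exact ⟨e ⟨c, hc⟩, by simpa [hFd c hc] using hcf⟩

/-! ### Hilbert–Samuel functions as counts of standard exponents -/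

/-- If each polynomial supported in `s` is congruent modulo `I` to a combination of standard
monomials with exponents in `s`, these monomials give a basis of the quotient. -/
theorem finrank_restrictSupport_quotient {K σ : Type*} [Field K] {m : MonomialOrder σ} {r : ℕ}
    {h : Fin r → MvPolynomial σ K} {I : Ideal (MvPolynomial σ K)} (hI : IsGroebnerBasis m h I)
    {s : Set (σ →₀ ℕ)} (hs : ∀ f ∈ restrictSupport K s,
      ∃ p ∈ restrictSupport K (s ∩ standardExponents m h), f - p ∈ I) :
    Module.finrank K (restrictSupport K s ⧸
      (I.restrictScalars K).submoduleOf (restrictSupport K s)) =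
      Nat.card ↥(s ∩ standardExponents m h) := by
  let U := restrictSupport K s
  let T := restrictSupport K (s ∩ standardExponents m h)
  have hTU : T ≤ U := restrictSupport_mono _ Set.inter_subset_left
  let q : T →ₗ[K] U ⧸ (I.restrictScalars K).submoduleOf U :=
    (Submodule.mkQ _).comp (Submodule.inclusion hTU)
  have hinj : Function.Injective q := by
    refine (injective_iff_map_eq_zero q).2 fun p hp => Subtype.ext ?_
    refine hI.eq_zero_of_mem_restrictSupport ?_
      (restrictSupport_mono K Set.inter_subset_right p.2)
    exact (Submodule.Quotient.mk_eq_zero ((I.restrictScalars K).submoduleOf U)).1 hp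
  have hsurj : Function.Surjective q := by
    intro y
    obtain ⟨f, rfl⟩ := Submodule.mkQ_surjective _ y
    obtain ⟨p, hp, hfp⟩ := hs f f.2
    refine ⟨⟨p, hp⟩, ((Submodule.Quotient.eq _).2 ?_).symm⟩
    exact hfp
  rw [← (LinearEquiv.ofBijective q ⟨hinj, hsurj⟩).finrank_eq]
  exact Module.finrank_eq_nat_card_basis (basisRestrictSupport K _)

theorem degree_le_of_degLex_le {σ : Type*} [LinearOrder σ] [WellFoundedGT σ] {a b : σ →₀ ℕ}
    (h : a ≼[degLex] b) : a.degree ≤ b.degree :=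
  Finsupp.DegLex.monotone_degree (degLex_le_iff.1 h)

/-- A graded order is needed here: division by `degLex` never raises the total degree, so remainders
stay in degree at most `d`. -/
theorem affineHilbertSamuel_eq {K : Type*} [Field K] {n r : ℕ} {V : Set (Fin n → K)}
    {h : Fin r → MvPolynomial (Fin n) K} (hV : IsGroebnerBasis degLex h (affineIdeal V)) (d : ℕ) :
    affineHilbertSamuel V d =
      Nat.card ↥({c : Fin n →₀ ℕ | (c.sum fun _ e => e) ≤ d} ∩ standardExponents degLex h) := by
  refine finrank_restrictSupport_quotient hV fun f hf => ?_
  by_cases h0 : f = 0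
  · exact ⟨0, zero_mem _, by simp [h0]⟩
  obtain ⟨p, hp, hfp, hdeg⟩ := exists_sub_mem_span_range degLex
    (fun j => (degLex.leadingCoeff_ne_zero_iff.2 (hV.1 j).2).isUnit) f
  refine ⟨p, (mem_restrictSupport_iff _).2 fun c hc =>
    ⟨?_, (mem_restrictSupport_iff _).1 hp hc⟩, ?_⟩
  · by_cases hcf : c ∈ f.support
    · exact (mem_restrictSupport_iff _).1 hf hcf
    have hc' : c ∈ (f - p).support := by
      rw [mem_support_iff, coeff_sub, notMem_support_iff.1 hcf, zero_sub, neg_ne_zero]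
      exact mem_support_iff.1 hc
    exact (degree_le_of_degLex_le (hdeg c hc')).trans
      ((mem_restrictSupport_iff _).1 hf (degLex.degree_mem_support h0))
  · exact Ideal.span_le.2 (by rintro _ ⟨j, rfl⟩; exact (hV.1 j).1) hfp

theorem eval_smul_of_isHomogeneous {R σ : Type*} [CommSemiring R] {f : MvPolynomial σ R} {d : ℕ}
    (hf : f.IsHomogeneous d) (t : R) (v : σ → R) : eval (t • v) f = t ^ d * eval v f := by
  rw [eval_eq, eval_eq, Finset.mul_sum]
  refine Finset.sum_congr rfl fun c hc => ?_
  have hd : ∑ i ∈ c.support, c i = d := by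
    rw [← Finsupp.degree_apply, Finsupp.degree_eq_weight_one]
    exact hf (mem_support_iff.1 hc)
  simp only [Pi.smul_apply, smul_eq_mul, mul_pow, Finset.prod_mul_distrib,
    Finset.prod_pow_eq_pow_sum, hd]
  ring

/-- For `v` in the cone, `t ↦ f (t • v)` is a polynomial in `t` vanishing at all `t ≠ 0`. Its
coefficients, the values at `v` of the homogeneous components, are therefore zero. -/
theorem homogeneousComponent_mem_projectiveIdeal {K : Type*} [Field K] [Infinite K] {n : ℕ}
    {V : Set (ℙ K (Fin (n + 1) → K))} {f : MvPolynomial (Fin (n + 1)) K}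
    (hf : f ∈ projectiveIdeal V) (d : ℕ) : homogeneousComponent d f ∈ projectiveIdeal V := by
  intro v hv
  obtain ⟨hv0, hvV⟩ := hv
  rw [aeval_eq_eval]
  let q : Polynomial K := ∑ i ∈ Finset.range (f.totalDegree + 1),
    Polynomial.monomial i (eval v (homogeneousComponent i f))
  have hq (t : K) : q.eval t = eval (t • v) f := by
    conv_rhs => rw [← sum_homogeneousComponent f]
    rw [map_sum, Polynomial.eval_finsetSum]
    refine Finset.sum_congr rfl fun i _ => ?_
    rw [Polynomial.eval_monomial, eval_smul_of_isHomogeneous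
      (homogeneousComponent_isHomogeneous i f), mul_comm]
  have hq0 : q = 0 := by
    refine Polynomial.eq_zero_of_infinite_isRoot q
      ((Set.finite_singleton (0 : K)).infinite_compl.mono fun t ht => ?_)
    have ht0 : t ≠ 0 := ht
    rw [Set.mem_ofPred_eq, Polynomial.IsRoot, hq, ← aeval_eq_eval]
    refine hf _ ⟨smul_ne_zero ht0 hv0, ?_⟩
    convert hvV using 1
    exact (Projectivization.mk_eq_mk_iff' K _ _ _ _).2 ⟨t, rfl⟩
  by_cases hd : d < f.totalDegree + 1
  · have h1 := congrArg (Polynomial.coeff · d) hq0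
    simpa [q, Polynomial.coeff_monomial, hd] using h1
  · rw [homogeneousComponent_eq_zero _ _ (by omega), map_zero]

/-- Any monomial order works: the degree `d` component of a remainder is still standard, and
homogeneity of the ideal keeps the congruence. -/
theorem projectiveHilbertSamuel_eq {K : Type*} [Field K] [Infinite K] {n r : ℕ}
    {V : Set (ℙ K (Fin (n + 1) → K))} {m : MonomialOrder (Fin (n + 1))}
    {h : Fin r → MvPolynomial (Fin (n + 1)) K} (hV : IsGroebnerBasis m h (projectiveIdeal V))
    (d : ℕ) :
    projectiveHilbertSamuel V d =
      Nat.card ↥({c : Fin (n + 1) →₀ ℕ | c.degree = d} ∩ standardExponents m h) := by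
  have key : homogeneousSubmodule (Fin (n + 1)) K d =
      restrictSupport K {c : Fin (n + 1) →₀ ℕ | c.degree = d} :=
    homogeneousSubmodule_eq_finsupp_supported _ _ _
  rw [projectiveHilbertSamuel, key]
  refine finrank_restrictSupport_quotient hV fun f hf => ?_
  obtain ⟨p, hp, hfp, -⟩ := exists_sub_mem_span_range m
    (fun j => (m.leadingCoeff_ne_zero_iff.2 (hV.1 j).2).isUnit) f
  refine ⟨homogeneousComponent d p, (mem_restrictSupport_iff _).2 fun c hc => ?_, ?_⟩
  · have hc' : coeff c (homogeneousComponent d p) ≠ 0 := mem_support_iff.1 hc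
    rw [coeff_homogeneousComponent] at hc'
    split_ifs at hc' with hcd
    · exact ⟨hcd, (mem_restrictSupport_iff _).1 hp (mem_support_iff.2 hc')⟩
    · exact absurd rfl hc'
  · rw [← key] at hf
    have h1 := homogeneousComponent_mem_projectiveIdeal
      ((Ideal.span_le.2 (by rintro _ ⟨j, rfl⟩; exact (hV.1 j).1) :
        Ideal.span (Set.range h) ≤ projectiveIdeal V) hfp) d
    rwa [map_sub, homogeneousComponent_of_mem hf, if_pos rfl] at h1

end GroebnerSpecialization

/-! ### The affine and projective statements -/

theorem mainTheorem4 {K : Type*} [RCLike K] (n : ℕ) :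
    -- the affine case
    (∀ (V : Set (Fin n → K)), IsAffineAlgebraicSet V →
      ∀ (s : ℕ) (g : Fin s → MvPolynomial (Fin n) K),
        Ideal.span (Set.range g) = affineIdeal V →
        (∃ ε₀ > (0 : ℝ), ∀ ε : ℝ, 0 < ε → ε < ε₀ →
          ∀ (W : Set (Fin n → K)) (g' : Fin s → MvPolynomial (Fin n) K),
            IsAffineAlgebraicSet W → Ideal.span (Set.range g') = affineIdeal W →
            IsAlgebraicApproximation ε g g' →
            affineHilbertSamuel W = affineHilbertSamuel V) ∧
        (∀ (m : MonomialOrder (Fin n)) (r : ℕ) (h : Fin r → MvPolynomial (Fin n) K),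
          IsGroebnerBasis m h (affineIdeal V) →
          ∃ ε₀ > (0 : ℝ), ∀ ε : ℝ, 0 < ε → ε < ε₀ →
            ∀ (W : Set (Fin n → K)) (g' : Fin s → MvPolynomial (Fin n) K),
              IsAffineAlgebraicSet W → Ideal.span (Set.range g') = affineIdeal W →
              IsAlgebraicApproximation ε g g' →
              ∃ h' : Fin r → MvPolynomial (Fin n) K, IsGroebnerBasis m h' (affineIdeal W) ∧
                ∀ j, m.degree (h' j) = m.degree (h j) ∧ (h' j).support ⊆ (h j).support)) ∧
    -- the projective case
    (∀ (V : Set (ℙ K (Fin (n + 1) → K))), IsProjectiveAlgebraicSet V →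
      ∀ (s : ℕ) (g : Fin s → MvPolynomial (Fin (n + 1)) K),
        Ideal.span (Set.range g) = projectiveIdeal V →
        (∃ ε₀ > (0 : ℝ), ∀ ε : ℝ, 0 < ε → ε < ε₀ →
          ∀ (W : Set (ℙ K (Fin (n + 1) → K))) (g' : Fin s → MvPolynomial (Fin (n + 1)) K),
            IsProjectiveAlgebraicSet W → Ideal.span (Set.range g') = projectiveIdeal W →
            IsAlgebraicApproximation ε g g' →
            projectiveHilbertSamuel W = projectiveHilbertSamuel V) ∧
        (∀ (m : MonomialOrder (Fin (n + 1))) (r : ℕ)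
            (h : Fin r → MvPolynomial (Fin (n + 1)) K),
          IsGroebnerBasis m h (projectiveIdeal V) →
          ∃ ε₀ > (0 : ℝ), ∀ ε : ℝ, 0 < ε → ε < ε₀ →
            ∀ (W : Set (ℙ K (Fin (n + 1) → K))) (g' : Fin s → MvPolynomial (Fin (n + 1)) K),
              IsProjectiveAlgebraicSet W → Ideal.span (Set.range g') = projectiveIdeal W →
              IsAlgebraicApproximation ε g g' →
              ∃ h' : Fin r → MvPolynomial (Fin (n + 1)) K,
                IsGroebnerBasis m h' (projectiveIdeal W) ∧
                ∀ j, m.degree (h' j) = m.degree (h j) ∧ (h' j).support ⊆ (h j).support)) := by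
  refine ⟨fun V _ s g hg => ⟨?_, fun m r h hh => ?_⟩, fun V _ s g hg => ⟨?_, fun m r h hh => ?_⟩⟩
  · obtain ⟨r, h, hh⟩ := exists_isGroebnerBasis MonomialOrder.degLex (affineIdeal V)
    obtain ⟨ε₀, hε₀, H⟩ := exists_isGroebnerBasis_of_isAlgebraicApproximation (hg ▸ hh)
    refine ⟨ε₀, hε₀, fun ε _ hε W g' _ hg' happ => funext fun d => ?_⟩
    obtain ⟨h', hh', hd⟩ := H ε hε g' happ
    rw [affineHilbertSamuel_eq (hg' ▸ hh'), affineHilbertSamuel_eq hh,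
      standardExponents_congr fun j => (hd j).1]
  · obtain ⟨ε₀, hε₀, H⟩ := exists_isGroebnerBasis_of_isAlgebraicApproximation (hg ▸ hh)
    refine ⟨ε₀, hε₀, fun ε _ hε W g' _ hg' happ => ?_⟩
    rw [← hg']
    exact H ε hε g' happ
  · obtain ⟨r, h, hh⟩ := exists_isGroebnerBasis MonomialOrder.degLex (projectiveIdeal V)
    obtain ⟨ε₀, hε₀, H⟩ := exists_isGroebnerBasis_of_isAlgebraicApproximation (hg ▸ hh)
    refine ⟨ε₀, hε₀, fun ε _ hε W g' _ hg' happ => funext fun d => ?_⟩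
    obtain ⟨h', hh', hd⟩ := H ε hε g' happ
    rw [projectiveHilbertSamuel_eq (hg' ▸ hh'), projectiveHilbertSamuel_eq hh,
      standardExponents_congr fun j => (hd j).1]
  · obtain ⟨ε₀, hε₀, H⟩ := exists_isGroebnerBasis_of_isAlgebraicApproximation (hg ▸ hh)
    refine ⟨ε₀, hε₀, fun ε _ hε W g' _ hg' happ => ?_⟩
    rw [← hg']
    exact H ε hε g' happ
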